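/- Let $J,K$ be natural numbers, let $Q=(q_{jk})$ be a $J\times K$ binary matrix with rows $\mathbf q_1,\dots,\mathbf q_J$, and for $\alpha,\beta\in\{0,1\}^K$ write $\alpha\succeq\beta$ if $\alpha_k\ge\beta_k$ for all $k$. Let $\mathbf e_k$ be the $k$-th standard basis vector of $\{0,1\}^K$, and let $\mathbf 0$ and $\mathbf 1$ be the all-zero and the all-one vector. The parameters of the $Q$-restricted latent class model are the pairs $(\Theta,\mathbf p)$ with $\Theta=(\theta_{j,\alpha})\in[0,1]^{J\times\{0,1\}^K}$ and $\mathbf p=(p_\alpha)_{\alpha\in\{0,1\}^K}$, $p_\alpha\in(0,1)$, $\sum_\alpha p_\alpha=1$, such that \[ \max_{\alpha\succeq\mathbf q_j}\theta_{j,\alpha}=\min_{\alpha\succeq\mathbf q_j}\theta_{j,\alpha}\ \ge\ \theta_{j,\alpha'}\ \ge\ \theta_{j,\mathbf 0}\qquad\text{for all } j \text{ and all } \alpha'\in\{0,1\}^K, \] and \[ \theta_{j,\mathbf 1}>\max_{\alpha\not\succeq\mathbf e_k}\theta_{j,\alpha}\qquad\text{for all } k \text{ and all } j \text{ with } \mathbf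 q_j=\mathbf e_k . \] The distribution of the binary response vector $\mathbf R\in\{0,1\}^J$ under $(\Theta,\mathbf p)$ is \[ P(\mathbf R=\mathbf r\mid\Theta,\mathbf p)=\sum_{\alpha\in\{0,1\}^K}p_\alpha\prod_{j=1}^J\theta_{j,\alpha}^{r_j}(1-\theta_{j,\alpha})^{1-r_j}. \] Theorem. Let $(\Theta,\mathbf p)$ be parameters of the $Q$-restricted latent class model. Suppose that (C1) after a reordering of its rows, $Q$ consists of two copies of the $K\times K$ identity matrix (rows $1,\dots,2K$) followed by a matrix $Q'$ (rows $j>2K$); (C2) for every $k\in\{1,\dots,K\}$ there is an item $j>2K$ (an item of $Q'$) with $\theta_{j,\mathbf e_k}\ne\theta_{j,\mathbf 0}$. Then $(\Theta,\mathbf p)$ is identifiable: for all parameters $(\bar\Theta,\bar{\mathbf p})$ of the $Q$-restricted latent class model, $P(\mathbf R=\mathbf r\mid\Theta,\mathbf p)=P(\mathbf R=\mathbf r\mid\bar\Theta,\bar{\mathbf p})$ holds for all $\mathbf r\in\{0,1\}^J$ if and only if $(\Theta,\mathbf p)=(\bar\Theta,\bar{\mathbf p})$. In particular, no relabelling of the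 latent classes is needed. -/

import Mathlib

namespace RestrictedLCM

/-- Attribute profiles (latent classes) `α ∈ {0,1}^K`. The order on them is the coordinatewise
one, so `q ≤ α` says that `α` possesses every attribute that `q` requires. -/
abbrev Profile (K : ℕ) : Type := Fin K → Fin 2

/-- Response vectors `r ∈ {0,1}^J`. -/
abbrev Response (J : ℕ) : Type := Fin J → Fin 2

/-- `Q`-matrices: `J × K` binary matrices; the row `Q j` lists the attributes linked to item `j`. -/
abbrev QMatrix (J K : ℕ) : Type := Matrix (Fin J) (Fin K) (Fin 2)

/-- The item parameters `Θ = (θ_{j,α})`, a `J × 2^K` real matrix. -/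
abbrev ItemParam (J K : ℕ) : Type := Matrix (Fin J) (Profile K) ℝ

/-- The profile `e_k` that has the attribute `k` and no other. -/
def unitProfile {K : ℕ} (k : Fin K) : Profile K := Pi.single k 1

/-- `Θ` consists of probabilities and satisfies the monotonicity relations attached to `Q`. -/
structure IsItemParam {J K : ℕ} (Q : QMatrix J K) (Θ : ItemParam J K) : Prop where
  /-- every entry is a probability -/
  mem_unit : ∀ j α, Θ j α ∈ Set.Icc (0 : ℝ) 1
  /-- `max_{α ⪰ q_j} θ_{j,α} = min_{α ⪰ q_j} θ_{j,α}` -/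
  capable_eq : ∀ j α β, Q j ≤ α → Q j ≤ β → Θ j α = Θ j β
  /-- the common value on `{α ⪰ q_j}` is at least `θ_{j,α'}` for every `α'` -/
  le_capable : ∀ j α α', Q j ≤ α → Θ j α' ≤ Θ j α
  /-- `θ_{j,α'} ≥ θ_{j,0}` for every `α'` -/
  zero_le : ∀ j α', Θ j 0 ≤ Θ j α'
  /-- if `q_j = e_k` then `θ_{j,1} > max_{α ⋡ e_k} θ_{j,α}` -/
  strict : ∀ j k, Q j = unitProfile k → ∀ α, ¬ unitProfile k ≤ α → Θ j α < Θ j 1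

/-- `p` is a vector of latent class proportions: `p_α ∈ (0,1)` and `∑_α p_α = 1`. -/
structure IsProportion {K : ℕ} (p : Profile K → ℝ) : Prop where
  mem_Ioo : ∀ α, p α ∈ Set.Ioo (0 : ℝ) 1
  sum_eq_one : ∑ α, p α = 1

/-- `P(R = r ∣ α)`: given the profile, the responses are independent Bernoulli variables with
success probabilities `θ_{j,α}`. -/
def condProb {J K : ℕ} (Θ : ItemParam J K) (r : Response J) (α : Profile K) : ℝ :=
  ∏ j, if r j = 1 then Θ j α else 1 - Θ j α

/-- `P(R = r ∣ Θ, p)`, the distribution of the response vector. -/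
def responseProb {J K : ℕ} (Θ : ItemParam J K) (p : Profile K → ℝ) (r : Response J) : ℝ :=
  ∑ α, condProb Θ r α * p α

/-- `(Θ, p)` is (strictly) identifiable: among all the admissible parameters of the model with the
matrix `Q`, only `(Θ, p)` itself has the response distribution of `(Θ, p)`. -/
def Identifiable {J K : ℕ} (Q : QMatrix J K) (Θ : ItemParam J K) (p : Profile K → ℝ) : Prop :=
  ∀ (Θ' : ItemParam J K) (p' : Profile K → ℝ), IsItemParam Q Θ' → IsProportion p' →
    ((∀ r, responseProb Θ p r = responseProb Θ' p' r) ↔ (Θ = Θ' ∧ p = p'))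

/-- After a reordering of the rows, `Q` consists of two copies of the `K × K` identity matrix and a
further matrix `Q'`: the `k`-th row of the first copy is the row `rows (inl k)` of `Q`, that of the
second copy is the row `rows (inr k)`, and these `2K` rows are distinct. -/
def HasTwoIdentities {J K : ℕ} (Q : QMatrix J K) (rows : Fin K ⊕ Fin K ↪ Fin J) : Prop :=
  ∀ k, Q (rows (Sum.inl k)) = unitProfile k ∧ Q (rows (Sum.inr k)) = unitProfile k

/-- For every attribute `k`, some item outside the two identity blocks (that is, an item of `Q'`)
has different positive response probabilities at `e_k` and at `0`. -/
def Separates {J K : ℕ} (Θ : ItemParam J K) (rows : Fin K ⊕ Fin K ↪ Fin J) : Prop :=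
  ∀ k, ∃ j, j ∉ Set.range rows ∧ Θ j (unitProfile k) ≠ Θ j 0

end RestrictedLCM

open Finset

namespace RestrictedLCM

/-! ### Binary profiles and moments of two blocks. -/

section Profiles

variable {K : ℕ}

/-! Each identity block `x`, `y` is maximal at attribute `k` exactly on the profiles having `k`.
Shifting by the maxima therefore kills profiles in a moment. Shift `x` by the maxima of one model
and `y` by those of the other: both sides collapse to the profile `0`, or to `0` and `e_k` when
attribute `k` is left out. The resulting two-component mixtures, weighted by an item outside the
blocks that separates `e_k` from `0`, determine the block values at `0` (`block_zero_eq`). These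
give the maxima (`top_eq`). With common maxima the moments are triangular in the order of profiles,
and induction recovers all parameters (`eq_of_forall_lt`, `leading_term_eq`). Labels are fixed by
the blocks, so no permutation arises. -/

theorem fin_two_eq_zero_of_ne_one {i : Fin 2} (h : i ≠ 1) : i = 0 := by omega

theorem unitProfile_le_iff {k : Fin K} {α : Profile K} : unitProfile k ≤ α ↔ α k = 1 := by
  constructor
  · intro h
    have := h k
    simp only [unitProfile, Pi.single_eq_same] at this
    omega
  · intro h i
    by_cases hi : i = k
    · subst hi; simp [unitProfile, h]
    · simp [unitProfile, hi]

theorem profile_le_of_zero {α β : Profile K} (h : ∀ k, α k = 0 → β k = 0) : β ≤ α := by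
  intro k
  by_cases hk : α k = 0
  · rw [h k hk, hk]
  · have : α k = 1 := by omega
    rw [this]; exact Fin.le_last _

theorem eq_zero_or_eq_unitProfile {k : Fin K} {α : Profile K} (h : ∀ i, i ≠ k → α i = 0) :
    α = 0 ∨ α = unitProfile k := by
  by_cases hk : α k = 0
  · left
    funext i
    by_cases hi : i = k
    · subst hi; exact hk
    · exact h i hi
  · right
    funext i
    by_cases hi : i = k
    · subst hi; simp only [unitProfile, Pi.single_eq_same]; omega
    · simp [unitProfile, hi, h i hi]

theorem unitProfile_ne_zero (k : Fin K) : unitProfile k ≠ 0 := by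
  intro h
  have := congrFun h k
  simp [unitProfile] at this

/-- For every attribute `k`, the function `x k` attains its maximum exactly on the profiles that
possess `k`, and its minimum at the zero profile. -/
structure HasTops (x : Fin K → Profile K → ℝ) : Prop where
  eq_top : ∀ k α, α k = 1 → x k α = x k 1
  lt_top : ∀ k α, α k = 0 → x k α < x k 1
  zero_le : ∀ k α, x k 0 ≤ x k α

namespace HasTops

variable {x : Fin K → Profile K → ℝ}

theorem eq_top_iff (hx : HasTops x) {k : Fin K} {α : Profile K} : x k α = x k 1 ↔ α k = 1 := by
  refine ⟨fun h => ?_, hx.eq_top k α⟩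
  by_contra h1
  exact (hx.lt_top k α (fin_two_eq_zero_of_ne_one h1)).ne h

theorem prod_ne_zero (hx : HasTops x) {S : Finset (Fin K)} {α : Profile K}
    (h : ∀ k ∈ S, α k = 0) : ∏ k ∈ S, (x k α - x k 1) ≠ 0 :=
  prod_ne_zero_iff.2 fun k hk => sub_ne_zero.2 (hx.lt_top k α (h k hk)).ne

theorem prod_eq_zero (hx : HasTops x) {S : Finset (Fin K)} {α : Profile K} {k : Fin K}
    (hk : k ∈ S) (h : α k ≠ 0) : ∏ k ∈ S, (x k α - x k 1) = 0 :=
  Finset.prod_eq_zero hk (sub_eq_zero.2 (hx.eq_top k α (by omega)))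

/-- The products of the functions `x k - x k 1` separate signed measures on the profiles. -/
theorem eq_zero_of_forall_sum_eq_zero (hx : HasTops x) {u : Profile K → ℝ}
    (hu : ∀ S : Finset (Fin K), ∑ β, (∏ k ∈ S, (x k β - x k 1)) * u β = 0) (α : Profile K) :
    u α = 0 := by
  induction α using WellFoundedLT.induction with
  | ind α ih =>
    -- This product vanishes at `β` unless `β ≤ α`; induction disposes of `β < α`.
    have h := hu {k | α k = 0}
    rw [sum_eq_single_of_mem α (mem_univ _)] at h
    · exact (mul_eq_zero.1 h).resolve_left (hx.prod_ne_zero (by simp))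
    · intro β _ hβ
      by_cases hle : ∀ k, α k = 0 → β k = 0
      · rw [ih β (lt_of_le_of_ne (profile_le_of_zero hle) hβ), mul_zero]
      · push Not at hle
        obtain ⟨k, hk, hk'⟩ := hle
        rw [hx.prod_eq_zero (k := k) (by simpa using hk) hk', zero_mul]

end HasTops

/-- The mixed moments of two blocks of variables, weighted by a further variable, are the same in
two latent class models. -/
def MomentsAgree (p p' : Profile K → ℝ) (x x' y y' : Fin K → Profile K → ℝ)
    (h h' : Profile K → ℝ) : Prop :=
  ∀ (A B : Finset (Fin K)) (σ τ : Fin K → ℝ),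
    ∑ α, (∏ k ∈ A, (x k α - σ k)) * (∏ k ∈ B, (y k α - τ k)) * h α * p α =
      ∑ α, (∏ k ∈ A, (x' k α - σ k)) * (∏ k ∈ B, (y' k α - τ k)) * h' α * p' α

variable {p p' : Profile K → ℝ} {x x' y y' : Fin K → Profile K → ℝ} {h h' : Profile K → ℝ}

namespace MomentsAgree

theorem symm (H : MomentsAgree p p' x x' y y' h h') : MomentsAgree p' p x' x y' y h' h :=
  fun A B σ τ => (H A B σ τ).symm

theorem swap (H : MomentsAgree p p' x x' y y' h h') : MomentsAgree p p' y y' x x' h h' := by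
  intro A B σ τ
  have := H B A τ σ
  simpa only [mul_comm (∏ k ∈ B, (_ : ℝ))] using this

/-- Otherwise the means of the `k`-th variable, centred at `x' k 1`, would have different signs.
This keeps mixed factors nonzero at the profile `0`. -/
theorem zero_lt_top (H : MomentsAgree p p' x x' y y' 1 1) (hp : ∀ α, 0 < p α)
    (hp' : ∀ α, 0 < p' α) (hx : HasTops x) (hx' : HasTops x') (k : Fin K) :
    x k 0 < x' k 1 := by
  by_contra! hle
  have h := H {k} ∅ (fun _ => x' k 1) 0
  simp only [prod_singleton, prod_empty, mul_one, Pi.one_apply] at h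
  have h1 : 0 < ∑ α, (x k α - x' k 1) * p α := by
    refine sum_pos' (fun α _ => mul_nonneg ?_ (hp α).le) ⟨1, mem_univ _, mul_pos ?_ (hp 1)⟩
    · linarith [hx.zero_le k α]
    · linarith [hx.lt_top k 0 rfl]
  have h2 : ∑ α, (x' k α - x' k 1) * p' α ≤ 0 := by
    refine sum_nonpos fun α _ => mul_nonpos_of_nonpos_of_nonneg ?_ (hp' α).le
    by_cases hk : α k = 1
    · linarith [hx'.eq_top k α hk]
    · linarith [hx'.lt_top k α (fin_two_eq_zero_of_ne_one hk)]
  linarith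

end MomentsAgree

/-! ### Recovering the values at the zero profile. -/

theorem sum_eq_zero_term (hx : HasTops x) (f : Profile K → ℝ) :
    ∑ α, (∏ k, (x k α - x k 1)) * f α = (∏ k, (x k 0 - x k 1)) * f 0 := by
  refine sum_eq_single_of_mem 0 (mem_univ _) fun α _ hα => ?_
  obtain ⟨k, hk⟩ := Function.ne_iff.1 hα
  rw [hx.prod_eq_zero (mem_univ k) hk, zero_mul]

theorem sum_eq_two_terms (hx : HasTops x) (k : Fin K) (f : Profile K → ℝ) :
    ∑ α, (∏ i ∈ univ.erase k, (x i α - x i 1)) * f α =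
      (∏ i ∈ univ.erase k, (x i 0 - x i 1)) * f 0 +
      (∏ i ∈ univ.erase k, (x i (unitProfile k) - x i 1)) * f (unitProfile k) := by
  rw [← sum_pair (f := fun α => (∏ i ∈ univ.erase k, (x i α - x i 1)) * f α)
    (unitProfile_ne_zero k).symm]
  refine (sum_subset (subset_univ _) fun α _ hα => ?_).symm
  have : ∃ i, i ≠ k ∧ α i ≠ 0 := by
    by_contra! hcon
    exact hα (by simpa using eq_zero_or_eq_unitProfile hcon)
  obtain ⟨i, hik, hi⟩ := this
  rw [hx.prod_eq_zero (by simp [hik]) hi, zero_mul]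

/-- The value of the weighting variable at the zero profile is determined by the moments. -/
theorem weight_zero_eq (hp : ∀ α, 0 < p α) (hp' : ∀ α, 0 < p' α)
    (hx : HasTops x) (hy : HasTops y) (hy' : HasTops y')
    (H1 : MomentsAgree p p' x x' y y' 1 1) (H : MomentsAgree p p' x x' y y' h h') :
    h 0 = h' 0 := by
  -- The shifts come from different models: the factors of `x` collapse the left side, those of `y'`
  -- the right side.
  have key : ∀ {g g' : Profile K → ℝ}, MomentsAgree p p' x x' y y' g g' →
      (∏ k, (x k 0 - x k 1)) * ((∏ k, (y k 0 - y' k 1)) * g 0 * p 0) =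
      (∏ k, (y' k 0 - y' k 1)) * ((∏ k, (x' k 0 - x k 1)) * g' 0 * p' 0) := by
    intro g g' Hg
    rw [← sum_eq_zero_term hx (fun α => (∏ k, (y k α - y' k 1)) * g α * p α),
      ← sum_eq_zero_term hy' (fun α => (∏ k, (x' k α - x k 1)) * g' α * p' α)]
    convert Hg univ univ (fun k => x k 1) (fun k => y' k 1) using 2 <;> ring
  have k1 := key H1
  have k2 := key H
  simp only [Pi.one_apply, mul_one] at k1
  have hne : (∏ k, (x k 0 - x k 1)) * (∏ k, (y k 0 - y' k 1)) * p 0 ≠ 0 := by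
    refine mul_ne_zero (mul_ne_zero (hx.prod_ne_zero (by simp)) ?_) (hp 0).ne'
    exact prod_ne_zero_iff.2 fun k _ =>
      sub_ne_zero.2 (H1.swap.zero_lt_top hp hp' hy hy' k).ne
  have : (∏ k, (x k 0 - x k 1)) * (∏ k, (y k 0 - y' k 1)) * p 0 * (h 0 - h' 0) = 0 := by
    linear_combination k2 - h' 0 * k1
  exact sub_eq_zero.1 ((mul_eq_zero.1 this).resolve_left hne)

/-- The first component of a two-component mixture is determined by its moments, even if the
weight of the second component vanishes. -/
theorem two_component_unique {w₀ w₁ v₀ v₁ a₀ a₁ c₀ c₁ b₀ b₁ d₀ d₁ z₀ z₁ z₁' : ℝ}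
    (hw : w₀ ≠ 0) (hv : v₀ ≠ 0)
    (ha : a₀ ≠ a₁) (hc : c₀ ≠ c₁) (hb : b₀ ≠ b₁) (hd : d₀ ≠ d₁) (hz : z₁ ≠ z₀)
    (m : w₀ + w₁ = v₀ + v₁)
    (ma : w₀ * a₀ + w₁ * a₁ = v₀ * c₀ + v₁ * c₁)
    (mb : w₀ * b₀ + w₁ * b₁ = v₀ * d₀ + v₁ * d₁)
    (mab : w₀ * a₀ * b₀ + w₁ * a₁ * b₁ = v₀ * c₀ * d₀ + v₁ * c₁ * d₁)
    (n : w₀ * z₀ + w₁ * z₁ = v₀ * z₀ + v₁ * z₁')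
    (na : w₀ * a₀ * z₀ + w₁ * a₁ * z₁ = v₀ * c₀ * z₀ + v₁ * c₁ * z₁')
    (nb : w₀ * b₀ * z₀ + w₁ * b₁ * z₁ = v₀ * d₀ * z₀ + v₁ * d₁ * z₁') :
    a₀ = c₀ ∧ b₀ = d₀ := by
  by_cases h1 : w₁ = 0
  · subst h1
    -- One component on the left means zero covariance, which forces the right side to degenerate
    -- too.
    have hdet : v₀ * v₁ * (c₁ - c₀) * (d₁ - d₀) = 0 := by
      have e1 : (v₀ + v₁) * (v₀ * c₀ * d₀ + v₁ * c₁ * d₁)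
          - (v₀ * c₀ + v₁ * c₁) * (v₀ * d₀ + v₁ * d₁) = 0 := by
        rw [← m, ← ma, ← mb, ← mab]; ring
      linear_combination e1
    have hv1 : v₁ = 0 := by
      simpa [hv, sub_ne_zero.2 hc.symm, sub_ne_zero.2 hd.symm] using hdet
    subst hv1
    have m' : v₀ = w₀ := by linarith
    subst m'
    exact ⟨mul_left_cancel₀ hv (by linarith), mul_left_cancel₀ hv (by linarith)⟩
  -- Subtracting `z₀` from the weights removes the first component.
  · have q : w₁ * (z₁ - z₀) = v₁ * (z₁' - z₀) := by linear_combination n - z₀ * m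
    have hq : w₁ * (z₁ - z₀) ≠ 0 := mul_ne_zero h1 (sub_ne_zero.2 hz)
    have ea : a₁ = c₁ := mul_left_cancel₀ hq (by linear_combination na - z₀ * ma + (-c₁) * q)
    have eb : b₁ = d₁ := mul_left_cancel₀ hq (by linear_combination nb - z₀ * mb + (-d₁) * q)
    subst ea eb
    -- Centring at the common second component leaves only the first.
    have ra : w₀ * (a₀ - a₁) = v₀ * (c₀ - a₁) := by linear_combination ma - a₁ * m
    have rb : w₀ * (b₀ - b₁) = v₀ * (d₀ - b₁) := by linear_combination mb - b₁ * m
    have rab : w₀ * (a₀ - a₁) * (b₀ - b₁) = v₀ * (c₀ - a₁) * (d₀ - b₁) := by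
      linear_combination mab - a₁ * mb - b₁ * ma + a₁ * b₁ * m
    refine ⟨mul_left_cancel₀ (mul_ne_zero hw (sub_ne_zero.2 hb)) ?_,
      mul_left_cancel₀ (mul_ne_zero hw (sub_ne_zero.2 ha)) ?_⟩
    · linear_combination rab + (a₁ - c₀) * rb
    · linear_combination rab + (b₁ - d₀) * ra

/-- The values of both blocks at the zero profile are determined by the moments, for each attribute
whose unit profile is separated from the zero profile by the weighting variable. -/
theorem block_zero_eq (hp : ∀ α, 0 < p α) (hp' : ∀ α, 0 < p' α)
    (hx : HasTops x) (hx' : HasTops x') (hy : HasTops y) (hy' : HasTops y')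
    (H1 : MomentsAgree p p' x x' y y' 1 1) (H : MomentsAgree p p' x x' y y' h h')
    {k : Fin K} (hk : h (unitProfile k) ≠ h 0) : x k 0 = x' k 0 ∧ y k 0 = y' k 0 := by
  have hz := weight_zero_eq hp hp' hx hy hy' H1 H
  have hunit : unitProfile k k = 1 := by simp [unitProfile]
  -- The Booleans record whether the `k`-th variable of each block enters the moment; its shift is
  -- `0`, so it enters unshifted.
  have key : ∀ (a b : Bool) {g g' : Profile K → ℝ}, MomentsAgree p p' x x' y y' g g' →
      (∏ i ∈ univ.erase k, (x i 0 - x i 1)) * ((∏ i ∈ univ.erase k, (y i 0 - y' i 1)) *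
        (if a then x k 0 else 1) * (if b then y k 0 else 1) * g 0 * p 0) +
      (∏ i ∈ univ.erase k, (x i (unitProfile k) - x i 1)) *
        ((∏ i ∈ univ.erase k, (y i (unitProfile k) - y' i 1)) *
        (if a then x k (unitProfile k) else 1) * (if b then y k (unitProfile k) else 1) *
        g (unitProfile k) * p (unitProfile k)) =
      (∏ i ∈ univ.erase k, (y' i 0 - y' i 1)) * ((∏ i ∈ univ.erase k, (x' i 0 - x i 1)) *
        (if a then x' k 0 else 1) * (if b then y' k 0 else 1) * g' 0 * p' 0) +
      (∏ i ∈ univ.erase k, (y' i (unitProfile k) - y' i 1)) *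
        ((∏ i ∈ univ.erase k, (x' i (unitProfile k) - x i 1)) *
        (if a then x' k (unitProfile k) else 1) * (if b then y' k (unitProfile k) else 1) *
        g' (unitProfile k) * p' (unitProfile k)) := by
    intro a b g g' Hg
    rw [← sum_eq_two_terms hx k (fun α => (∏ i ∈ univ.erase k, (y i α - y' i 1)) *
        (if a then x k α else 1) * (if b then y k α else 1) * g α * p α),
      ← sum_eq_two_terms hy' k (fun α => (∏ i ∈ univ.erase k, (x' i α - x i 1)) *
        (if a then x' k α else 1) * (if b then y' k α else 1) * g' α * p' α)]
    have hprod : ∀ (c : Bool) (f : Fin K → Profile K → ℝ) (σ : Fin K → ℝ) (α : Profile K),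
        ∏ i ∈ (if c then univ else univ.erase k), (f i α - Function.update σ k 0 i) =
          (if c then f k α else 1) * ∏ i ∈ univ.erase k, (f i α - σ i) := by
      intro c f σ α
      have e : ∏ i ∈ univ.erase k, (f i α - Function.update σ k 0 i) =
          ∏ i ∈ univ.erase k, (f i α - σ i) :=
        prod_congr rfl fun i hi => by rw [Function.update_of_ne (ne_of_mem_erase hi)]
      cases c
      · simpa using e
      · simp only [if_true]
        rw [← mul_prod_erase _ _ (mem_univ k), e, Function.update_self, sub_zero]
    have := Hg (if a then univ else univ.erase k) (if b then univ else univ.erase k)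
      (Function.update (fun i => x i 1) k 0) (Function.update (fun i => y' i 1) k 0)
    simp only [hprod] at this
    convert this using 2 <;> ring
  have hlt := fun i => H1.swap.zero_lt_top hp hp' hy hy' i
  have hlt' := fun i => H1.symm.zero_lt_top hp' hp hx' hx i
  refine two_component_unique
    (w₀ := (∏ i ∈ univ.erase k, (x i 0 - x i 1)) *
      (∏ i ∈ univ.erase k, (y i 0 - y' i 1)) * p 0)
    (w₁ := (∏ i ∈ univ.erase k, (x i (unitProfile k) - x i 1)) *
      (∏ i ∈ univ.erase k, (y i (unitProfile k) - y' i 1)) * p (unitProfile k))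
    (v₀ := (∏ i ∈ univ.erase k, (y' i 0 - y' i 1)) *
      (∏ i ∈ univ.erase k, (x' i 0 - x i 1)) * p' 0)
    (v₁ := (∏ i ∈ univ.erase k, (y' i (unitProfile k) - y' i 1)) *
      (∏ i ∈ univ.erase k, (x' i (unitProfile k) - x i 1)) * p' (unitProfile k))
    (a₁ := x k (unitProfile k)) (c₁ := x' k (unitProfile k))
    (b₁ := y k (unitProfile k)) (d₁ := y' k (unitProfile k))
    (z₁ := h (unitProfile k)) (z₀ := h 0) (z₁' := h' (unitProfile k))
    ?_ ?_ ?_ ?_ ?_ ?_ hk ?_ ?_ ?_ ?_ ?_ ?_ ?_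
  · exact mul_ne_zero (mul_ne_zero (hx.prod_ne_zero (by simp))
      (prod_ne_zero_iff.2 fun i _ => sub_ne_zero.2 (hlt i).ne)) (hp 0).ne'
  · exact mul_ne_zero (mul_ne_zero (hy'.prod_ne_zero (by simp))
      (prod_ne_zero_iff.2 fun i _ => sub_ne_zero.2 (hlt' i).ne)) (hp' 0).ne'
  · rw [hx.eq_top k _ hunit]; exact (hx.lt_top k 0 rfl).ne
  · rw [hx'.eq_top k _ hunit]; exact (hx'.lt_top k 0 rfl).ne
  · rw [hy.eq_top k _ hunit]; exact (hy.lt_top k 0 rfl).ne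
  · rw [hy'.eq_top k _ hunit]; exact (hy'.lt_top k 0 rfl).ne
  · have := key false false H1
    simp at this
    linear_combination this
  · have := key true false H1
    simp at this
    linear_combination this
  · have := key false true H1
    simp at this
    linear_combination this
  · have := key true true H1
    simp at this
    linear_combination this
  · have := key false false H
    simp [← hz] at this
    linear_combination this
  · have := key true false H
    simp [← hz] at this
    linear_combination this
  · have := key false true H
    simp [← hz] at this
    linear_combination this

/-! ### Maxima and induction over profiles. -/

/-- Once the values at the zero profile are known, the maxima of the first block are determined. -/
theorem top_eq (hp' : ∀ α, 0 < p' α)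
    (hx : HasTops x) (hx' : HasTops x') (hy' : HasTops y')
    (H1 : MomentsAgree p p' x x' y y' 1 1)
    (hy0 : ∀ k, y k 0 = y' k 0) (k : Fin K) : x k 1 = x' k 1 := by
  have hvanish : ∀ β, β ≠ 0 → ∏ k, (x' k β - x k 1) = 0 := by
    intro β hβ
    -- The signed measure is the `x`-weighted second model minus the point mass to which the first
    -- collapses; `hy0` makes the `y`-moments match.
    have hu := hy'.eq_zero_of_forall_sum_eq_zero
      (u := fun β => (∏ k, (x' k β - x k 1)) * p' β -
        if β = 0 then (∏ k, (x k 0 - x k 1)) * p 0 else 0) ?_ β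
    · simpa [hβ, (hp' β).ne'] using hu
    · intro S
      have e := H1 univ S (fun k => x k 1) (fun k => y' k 1)
      simp only [Pi.one_apply, mul_one, mul_assoc] at e
      rw [sum_eq_zero_term hx (fun α => (∏ k ∈ S, (y k α - y' k 1)) * p α)] at e
      simp only [mul_sub, sum_sub_distrib, mul_ite, mul_zero, sum_ite_eq', mem_univ, if_true,
        mul_left_comm (∏ k ∈ S, (_ : ℝ))]
      simp only [hy0] at e
      rw [← e]
      ring
  by_contra hk
  -- Test the profile of the attributes whose maxima differ: no factor can vanish there.
  obtain ⟨i, -, hi⟩ := prod_eq_zero_iff.1 (hvanish (fun i => if x i 1 ≠ x' i 1 then 1 else 0)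
    (fun h0 => by simpa [hk] using congrFun h0 k))
  rw [sub_eq_zero] at hi
  by_cases hi' : x i 1 = x' i 1
  · rw [hi', hx'.eq_top_iff] at hi
    simp [hi'] at hi
  · exact hi' (by rw [← hi]; exact hx'.eq_top i _ (by simp [hi']))

/-- If the maxima of the first block agree and the two models agree below `α`, then the leading
terms of the moments agree at `α`. -/
theorem leading_term_eq (hx : HasTops x) (hx' : HasTops x') (htop : ∀ k, x k 1 = x' k 1)
    {α : Profile K} (hpα : ∀ β < α, p β = p' β) (hxα : ∀ β < α, ∀ k, x k β = x' k β)
    {f f' : Profile K → ℝ} (hfα : ∀ β < α, f β = f' β)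
    (Hf : ∀ A : Finset (Fin K), ∑ β, (∏ k ∈ A, (x k β - x k 1)) * f β * p β =
      ∑ β, (∏ k ∈ A, (x' k β - x k 1)) * f' β * p' β) :
    (∏ k with α k = 0, (x k α - x k 1)) * f α * p α =
      (∏ k with α k = 0, (x' k α - x k 1)) * f' α * p' α := by
  have e := Hf {k | α k = 0}
  rw [← add_sum_erase _ _ (mem_univ α), ← add_sum_erase _ _ (mem_univ α)] at e
  refine add_right_cancel (e.trans (congrArg _ (sum_congr rfl fun β hβ => ?_).symm))
  by_cases hle : ∀ k, α k = 0 → β k = 0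
  · have hlt := lt_of_le_of_ne (profile_le_of_zero hle) (ne_of_mem_erase hβ)
    simp only [hxα β hlt, hfα β hlt, hpα β hlt]
  · push Not at hle
    obtain ⟨k, hk, hk'⟩ := hle
    have e' := hx'.prod_eq_zero (S := {k | α k = 0}) (k := k) (by simpa using hk) hk'
    simp only [← htop] at e'
    rw [hx.prod_eq_zero (S := {k | α k = 0}) (k := k) (by simpa using hk) hk', e']
    simp

/-- If the maxima of the first block agree and the two models agree below `α`, then all further
variables agree at `α`. -/
theorem eq_of_forall_lt (hp : ∀ α, 0 < p α) (hx : HasTops x) (hx' : HasTops x')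
    (htop : ∀ k, x k 1 = x' k 1) {α : Profile K}
    (hpα : ∀ β < α, p β = p' β) (hxα : ∀ β < α, ∀ k, x k β = x' k β)
    (H : ∀ A : Finset (Fin K), ∑ β, (∏ k ∈ A, (x k β - x k 1)) * p β =
      ∑ β, (∏ k ∈ A, (x' k β - x k 1)) * p' β)
    {f f' : Profile K → ℝ} (hfα : ∀ β < α, f β = f' β)
    (Hf : ∀ A : Finset (Fin K), ∑ β, (∏ k ∈ A, (x k β - x k 1)) * f β * p β =
      ∑ β, (∏ k ∈ A, (x' k β - x k 1)) * f' β * p' β) : f α = f' α := by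
  have e1 := leading_term_eq hx hx' htop hpα hxα (f := 1) (f' := 1) (fun _ _ => rfl)
    (by simpa using H)
  have e2 := leading_term_eq hx hx' htop hpα hxα hfα Hf
  simp only [Pi.one_apply, mul_one] at e1
  refine mul_left_cancel₀
    (mul_ne_zero (hx.prod_ne_zero (S := {k | α k = 0}) (α := α) (by simp)) (hp α).ne') ?_
  linear_combination e2 - f' α * e1

end Profiles

/-! ### From response probabilities to parameters. -/

section Model

variable {J K : ℕ}

/-- Shifted moments are linear combinations of response probabilities. -/
theorem sum_prod_sub_eq (Θ : ItemParam J K) (p : Profile K → ℝ) (S : Finset (Fin J))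
    (τ : Fin J → ℝ) :
    ∑ α, (∏ j ∈ S, (Θ j α - τ j)) * p α =
      ∑ r : Response J, (∏ j, if j ∈ S then (if r j = 1 then 1 - τ j else -τ j) else 1) *
        responseProb Θ p r := by
  simp only [responseProb, condProb, mul_sum]
  rw [sum_comm]
  refine sum_congr rfl fun α _ => ?_
  simp only [← mul_assoc, ← sum_mul, ← prod_mul_distrib]
  congr 1
  -- Expands item by item: `θ - τ = (1 - τ)θ - τ(1 - θ)`, and `1 = θ + (1 - θ)` off `S`.
  have := (prod_univ_sum (fun _ : Fin J => (univ : Finset (Fin 2))) (fun j i =>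
    (if j ∈ S then (if i = 1 then 1 - τ j else -τ j) else 1) *
      (if i = 1 then Θ j α else 1 - Θ j α))).symm
  rw [Fintype.piFinset_univ] at this
  rw [this, ← prod_ite_mem_eq]
  refine prod_congr rfl fun j _ => ?_
  rw [Fin.sum_univ_two]
  by_cases hj : j ∈ S
  · simp [hj]; ring
  · simp [hj]

theorem hasTops_of_rows {Q : QMatrix J K} {Θ : ItemParam J K} (hΘ : IsItemParam Q Θ)
    {a : Fin K → Fin J} (ha : ∀ k, Q (a k) = unitProfile k) : HasTops fun k => Θ (a k) where
  eq_top k α h := hΘ.capable_eq _ _ _ (by rw [ha, unitProfile_le_iff, h])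
    (by rw [ha, unitProfile_le_iff]; rfl)
  lt_top k α h := hΘ.strict _ k (ha k) α (by rw [unitProfile_le_iff, h]; simp)
  zero_le k α := hΘ.zero_le _ α

variable {Θ Θ' : ItemParam J K} {p p' : Profile K → ℝ} {rows : Fin K ⊕ Fin K ↪ Fin J}

theorem momentsAgree_one (h : ∀ r, responseProb Θ p r = responseProb Θ' p' r) :
    MomentsAgree p p' (fun k => Θ (rows (.inl k))) (fun k => Θ' (rows (.inl k)))
      (fun k => Θ (rows (.inr k))) (fun k => Θ' (rows (.inr k))) 1 1 := by
  intro A B σ τ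
  have := sum_prod_sub_eq Θ p ((A.disjSum B).map rows) (Function.extend rows (Sum.elim σ τ) 0)
  simp only [h] at this
  rw [← sum_prod_sub_eq] at this
  simpa [prod_map, prod_disjSum, rows.injective.extend_apply] using this

theorem momentsAgree_item (h : ∀ r, responseProb Θ p r = responseProb Θ' p' r) {j : Fin J}
    (hj : j ∉ Set.range rows) :
    MomentsAgree p p' (fun k => Θ (rows (.inl k))) (fun k => Θ' (rows (.inl k)))
      (fun k => Θ (rows (.inr k))) (fun k => Θ' (rows (.inr k))) (Θ j) (Θ' j) := by
  intro A B σ τ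
  have hj' : j ∉ (A.disjSum B).map rows := fun hm => by
    obtain ⟨i, -, hi⟩ := mem_map.1 hm
    exact hj ⟨i, hi⟩
  have := sum_prod_sub_eq Θ p (insert j ((A.disjSum B).map rows))
    (Function.extend rows (Sum.elim σ τ) 0)
  simp only [h] at this
  rw [← sum_prod_sub_eq] at this
  -- The default shift `0` off the blocks leaves `Θ j` itself as the weight.
  have hj0 : Function.extend rows (Sum.elim σ τ) 0 j = 0 :=
    Function.extend_apply' _ _ _ (by simpa using hj)
  simp only [prod_insert hj', hj0, sub_zero, prod_map, prod_disjSum,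
    rows.injective.extend_apply, Sum.elim_inl, Sum.elim_inr] at this
  simpa only [mul_comm, mul_left_comm] using this

theorem param_eq {J K : ℕ} {Q : QMatrix J K} {Θ Θ' : ItemParam J K} {p p' : Profile K → ℝ}
    (hΘ : IsItemParam Q Θ) (hΘ' : IsItemParam Q Θ') (hp : ∀ α, 0 < p α) (hp' : ∀ α, 0 < p' α)
    {rows : Fin K ⊕ Fin K ↪ Fin J} (hC1 : HasTwoIdentities Q rows) (hC2 : Separates Θ rows)
    (h : ∀ r, responseProb Θ p r = responseProb Θ' p' r) : Θ = Θ' ∧ p = p' := by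
  have hx := hasTops_of_rows hΘ fun k => (hC1 k).1
  have hy := hasTops_of_rows hΘ fun k => (hC1 k).2
  have hx' := hasTops_of_rows hΘ' fun k => (hC1 k).1
  have hy' := hasTops_of_rows hΘ' fun k => (hC1 k).2
  have H1 := momentsAgree_one (rows := rows) h
  have hzero := fun k => (hC2 k).elim fun j hj =>
    block_zero_eq hp hp' hx hx' hy hy' H1 (momentsAgree_item h hj.1) hj.2
  have htx := top_eq hp' hx hx' hy' H1 fun k => (hzero k).2
  have hty := top_eq hp' hy hy' hx' H1.swap fun k => (hzero k).1
  have main : ∀ α, (∀ j, Θ j α = Θ' j α) ∧ p α = p' α := by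
    intro α
    induction α using WellFoundedLT.induction with
    | ind α ih =>
      have hpα : ∀ β < α, p β = p' β := fun β hβ => (ih β hβ).2
      have H1x : ∀ A : Finset (Fin K), _ := fun A => by
        simpa using H1 A ∅ (fun k => Θ (rows (.inl k)) 1) 0
      have H1y : ∀ A : Finset (Fin K), _ := fun A => by
        simpa using H1 ∅ A 0 (fun k => Θ (rows (.inr k)) 1)
      have hitem : ∀ j, Θ j α = Θ' j α := by
        intro j
        by_cases hj : j ∈ Set.range rows
        · obtain ⟨k | k, rfl⟩ := hj
          -- An item of one block is a weight for the other block.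
          · exact eq_of_forall_lt hp hy hy' hty hpα (fun β hβ k => (ih β hβ).1 _) H1y
              (fun β hβ => (ih β hβ).1 _) fun A => by
              simpa [mul_comm, mul_left_comm] using
                H1 {k} A 0 (fun k => Θ (rows (.inr k)) 1)
          · exact eq_of_forall_lt hp hx hx' htx hpα (fun β hβ k => (ih β hβ).1 _) H1x
              (fun β hβ => (ih β hβ).1 _) fun A => by
              simpa [mul_comm, mul_left_comm] using
                H1 A {k} (fun k => Θ (rows (.inl k)) 1) 0
        · exact eq_of_forall_lt hp hx hx' htx hpα (fun β hβ k => (ih β hβ).1 _) H1x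
              (fun β hβ => (ih β hβ).1 _) fun A => by
            simpa using momentsAgree_item h hj A ∅ (fun k => Θ (rows (.inl k)) 1) 0
      refine ⟨hitem, ?_⟩
      have e := leading_term_eq hx hx' htx hpα (fun β hβ k => (ih β hβ).1 _) (f := 1) (f' := 1)
        (fun _ _ => rfl) (by simpa using H1x)
      simp only [Pi.one_apply, mul_one, ← hitem] at e
      exact mul_left_cancel₀ (hx.prod_ne_zero (by simp)) e
  exact ⟨funext fun j => funext fun α => (main α).1 j, funext fun α => (main α).2⟩

end Model

end RestrictedLCM

theorem theorem1 {J K : ℕ} (Q : RestrictedLCM.QMatrix J K)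
    (Θ : RestrictedLCM.ItemParam J K) (p : RestrictedLCM.Profile K → ℝ)
    (hΘ : RestrictedLCM.IsItemParam Q Θ) (hp : RestrictedLCM.IsProportion p)
    (rows : Fin K ⊕ Fin K ↪ Fin J)
    (hC1 : RestrictedLCM.HasTwoIdentities Q rows)
    (hC2 : RestrictedLCM.Separates Θ rows) :
    RestrictedLCM.Identifiable Q Θ p := by
  intro Θ' p' hΘ' hp'
  refine ⟨RestrictedLCM.param_eq hΘ hΘ' (fun α => (hp.mem_Ioo α).1) (fun α => (hp'.mem_Ioo α).1) hC1 hC2, ?_⟩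
  rintro ⟨rfl, rfl⟩ r
  rfl
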